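/- **Model.** There are $n$ participants $\{1,\dots,n\}$ in a complete synchronous network with authenticated channels: in each round every participant sends messages to all participants (itself included) and then receives the messages sent to it in that round. A set $F$ of participants with $|F|\le f$ is Byzantine and behaves arbitrarily; it may even see the messages of the correct ones before sending its own. The others, $C=\{1,\dots,n\}\setminus F$, follow the algorithm. Messages can be signed, and signatures of correct participants cannot be forged: a Byzantine participant can send a signature of a correct participant only if that participant has itself issued it, in the same round or earlier. **Lattice agreement.** $L_n$ is the lattice of subsets of $\{1,\dots,n\}$ with union as join, and the allowed proposals are $E=\{\{1\},\dots,\{n\}\}$. Each $p\in C$ has a proposal $pro_p\in E$. An algorithm is a *correct Byzantine lattice agreement algorithm* if in every execution: each $p\in C$ eventually outputs a decision $dec_p\in L_n$ (liveness), and never changes it (stability); $dec_p\subseteq dec_q$ or $dec_q\subseteq dec_p$ for all $p,q\in C$ (comparability); $pro_p\subseteq dec_p$ for all $p\in C$ (inclusivity); and there is $B\subseteq E$ with $|B|\le f$ such that $dec_p\subseteq\bigcup(\{pro_q:q\in C\}\cup B)$ for all $p\in C$ (non-triviality). **Provable gradecast** of a message from a source $s$ in epoch $e$ (three rounds). Round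 1: $s$ broadcasts its message. Round 2: each participant broadcasts a message received from $s$ in round 1 (if there is one). Round 3: each participant takes the message received in round 2 from the most participants and, if it came from at least $n-f$ of them, broadcasts it together with its signature on (message, $s$, $e$). At the end each participant takes the message $m$ received, correctly signed by its sender, from the most participants: if these are at least $n-f$, it delivers $m$ with rank $2$ and with a *seen-all proof*, consisting of $n-f$ of these signatures; if they are at least $f+1$ but fewer than $n-f$, it delivers $m$ with rank $1$; otherwise it delivers nothing (rank $0$). Ties are broken arbitrarily. **The algorithm** $\mathrm{GAC}_{fast}$ runs epochs $0,1,\dots,\lceil\log_2 f\rceil+1$ (with $\lceil\log_2 0\rceil:=0$); in each of them all participants gradecast in parallel. A participant holds a set $V$ of values, a group $G$ (a string over $\{s,m\}$, initially empty), thresholds $t_d,t_u$, with $t_m=t_d+\lfloor (t_u-t_d)/2\rfloor$, and a table of proofs. *Epoch 0.* It gradecasts its proposal (one value), lets $V$ be the set of the values of $E$ delivered with rank $2$, keeps a seen-all proof for each of them, and sets $G=s$, $t_d=n-f$, $t_u=n$. *Epoch $e\ge1$.* It gradecasts $V$, $G$ and its proofs. A message with claimed group $G$ that contains $v$ *admissibly*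 is defined recursively: in epoch $0$ (empty group) the message is the single value $v$, and in later epochs the message contains $v$ and, for each $t<|G|$ with $G[t]=s$, a valid proof of epoch $t$, i.e. at least $n-f$ signatures on one message gradecast from one source in epoch $t$ with claimed group $G[0]\cdots G[t-1]$ that itself contains $v$ admissibly. Let $V'$ be the set of the $v\in E$ contained admissibly in a message delivered with rank at least $1$ whose claimed group is the participant's own group $G$. If $|V'|\le t_m$, the participant becomes a slave: it keeps $V$, appends $s$ to $G$, sets $t_u:=t_m$, and stores for each $v\in V$ valid proofs of the earlier epochs, taken from delivered messages, and a seen-all proof of this epoch, from a message delivered with rank $2$ with group $G$ (before the update) that contains $v$ admissibly. Otherwise it becomes a master: it sets $V:=V'$, appends $m$ to $G$, sets $t_d:=t_m$, and stores for each $v\in V$ valid proofs of the earlier epochs, taken from delivered messages. After the last epoch it decides the union of the elements of $V$. **Theorem.** There is a function $T(f)=O(\log f)$, depending on $f$ only, such that for all $n,f$ with $3f<n$, all sets $F$ of at most $f$ Byzantine participants, all pairwise distinct proposals $pro_p\in\{\{1\},\dots,\{n\}\}$ of the correct participants and every behaviour of the Byzantine participants that respects unforgeability, the execution of $\mathrm{GAC}_{fast}$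 satisfies liveness, stability, comparability, inclusivity and non-triviality, and every correct participant has decided after at most $T(f)$ rounds. -/

import Mathlib

noncomputable section

namespace ByzLA

section Model

/-! ### Synchronous message passing with Byzantine participants -/

/-- A deterministic synchronous algorithm for participants `ι`. Rounds are numbered from `0`; in round
`r` a participant in state `x` sends the packet `send r x q` to each `q` (itself included), and then
updates its state from the packets received, indexed by their (authenticated) sender. -/
structure SyncAlg (ι Input Packet Output : Type) where
  State : Type
  init : ι → Input → State
  send : ℕ → State → ι → Packet
  receive : ℕ → State → (ι → Packet) → State
  output : State → Option Output

variable {ι Input Packet Output : Type}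

open Classical in
/-- The packets of round `r`, from the states `x` before the round: a correct participant follows the
algorithm, a participant in `F` sends what the adversary `adv` wants. -/
def SyncAlg.deliver (A : SyncAlg ι Input Packet Output) (F : Finset ι)
    (adv : ℕ → ι → ι → Packet) (r : ℕ) (x : ι → A.State) (p q : ι) : Packet :=
  if p ∈ F then adv r p q else A.send r (x p) q

/-- The states after `r` rounds (meaningful for the participants outside `F`). -/
def SyncAlg.run (A : SyncAlg ι Input Packet Output) (F : Finset ι) (input : ι → Input)
    (adv : ℕ → ι → ι → Packet) : ℕ → ι → A.State
  | 0 => fun p => A.init p (input p)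
  | r + 1 => fun p =>
      A.receive r (A.run F input adv r p)
        (fun q => A.deliver F adv r (A.run F input adv r) q p)

/-- The packet that `p` sends to `q` in round `r` of the execution. -/
def SyncAlg.sent (A : SyncAlg ι Input Packet Output) (F : Finset ι) (input : ι → Input)
    (adv : ℕ → ι → ι → Packet) (r : ℕ) (p q : ι) : Packet :=
  A.deliver F adv r (A.run F input adv r) p q

/-- What `p` has output after `r` rounds of the execution. -/
def SyncAlg.out (A : SyncAlg ι Input Packet Output) (F : Finset ι) (input : ι → Input)
    (adv : ℕ → ι → ι → Packet) (r : ℕ) (p : ι) : Option Output :=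
  A.output (A.run F input adv r p)

/-! ### Byzantine lattice agreement -/

open Classical in
/-- The Byzantine lattice agreement problem on a join semilattice `V` with allowed proposals `E`: the
participants in `C` are correct, `pro` are their proposals, and `out r p` is what `p` has output after
`r` rounds. -/
structure IsLatticeAgreement {V : Type} [SemilatticeSup V] [OrderBot V] (E : Set V) (f : ℕ)
    (C : Finset ι) (pro : ι → V) (out : ℕ → ι → Option V) : Prop where
  liveness : ∀ p ∈ C, ∃ r d, out r p = some d
  stability : ∀ p ∈ C, ∀ r r' d, r ≤ r' → out r p = some d → out r' p = some d
  comparability : ∀ p ∈ C, ∀ q ∈ C, ∀ r r' d d', out r p = some d → out r' q = some d' →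
    d ≤ d' ∨ d' ≤ d
  inclusivity : ∀ p ∈ C, ∀ r d, out r p = some d → pro p ≤ d
  nonTriviality : ∃ B : Finset V, (B : Set V) ⊆ E ∧ B.card ≤ f ∧
    ∀ p ∈ C, ∀ r d, out r p = some d → d ≤ (C.image pro ∪ B).sup id

end Model

/-! ### Messages and signatures -/

/-- An element of the lattice `L_n`: a set of labels, ordered by inclusion, with union as join. -/
abbrev Val (n : ℕ) : Type := Finset (Fin n)

/-- The allowed proposals: the singletons. -/
def allowed (n : ℕ) : Finset (Val n) := Finset.univ.image fun i => {i}

/-- The two classes into which an epoch splits a group. -/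
inductive Role
  | slave
  | master

/-- A group is the list of the classifications so far; the empty group is `[]`. -/
abbrev Group : Type := List Role

mutual
/-- The messages that are gradecast. In epoch `0` a message is a single proposed value (its group is
the empty one and there are no proofs); in a later epoch it is a set of values, the group that the
sender claims to belong to, and a table of proofs: the entry `proofs v t` is meant to show that `v` was
seen in epoch `t`. -/
inductive Msg (n : ℕ) : Type
  | propose (v : Finset (Fin n)) : Msg n
  | update (pro : Finset (Finset (Fin n))) (group : List Role)
      (proofs : Finset (Fin n) → ℕ → Cert n) : Msg n
/-- A certificate: nothing, or a seen-all proof. At epoch `t`, `seenAll source body signers` consists of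
the signatures of all the `signers` under `body` as a message gradecast by `source` in epoch `t`. -/
inductive Cert (n : ℕ) : Type
  | bot : Cert n
  | seenAll (source : Fin n) (body : Msg n) (signers : Finset (Fin n)) : Cert n
end

instance (n : ℕ) : Inhabited (Cert n) := ⟨.bot⟩

variable {n : ℕ}

/-- The group claimed by the sender of a message. -/
def Msg.group : Msg n → Group
  | .propose _ => []
  | .update _ g _ => g

/-- The entry of the table of proofs of a message. -/
def Msg.proofs : Msg n → Val n → ℕ → Cert n
  | .propose _ => fun _ _ => .bot
  | .update _ _ tab => tab

mutual
/-- `M.Carries k v`: the message `M` contains the value `v`, together with an admissibility proof for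
`v` and the group `G` claimed in `M`, where seen-all proofs need `k` signatures. That is, for each
prefix of `G` that ends with `slave`, say at position `t`, there is a valid seen-all proof of epoch
`t` for `v` and the group `G.take t`. No proof is needed in epoch `0`. -/
def Msg.Carries (k : ℕ) (v : Finset (Fin n)) : Msg n → Prop
  | .propose w => w = v
  | .update pro g tab => g ≠ [] ∧ v ∈ pro ∧
      ∀ t, g[t]? = some Role.slave → Cert.Supports k v (g.take t) (tab v t)
/-- A valid seen-all proof for `v` and the group `g` has at least `k` signatures under a message that
was gradecast by a member of `g` and that carries `v`. -/
def Cert.Supports (k : ℕ) (v : Finset (Fin n)) (g : List Role) : Cert n → Prop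
  | .bot => False
  | .seenAll _ body signers => k ≤ signers.card ∧ body.group = g ∧ Msg.Carries k v body
end

/-- The signature of `signer` under `body`, as a message of the gradecast instance of `source` in the
given epoch. -/
structure Sig (n : ℕ) where
  signer : Fin n
  epoch : ℕ
  source : Fin n
  body : Msg n

/-- The signature `σ` occurs in a message. -/
inductive Msg.Contains (σ : Sig n) : Msg n → Prop
  | here {pro g tab} {v : Val n} {signers : Finset (Fin n)}
      (h : tab v σ.epoch = Cert.seenAll σ.source σ.body signers) (hs : σ.signer ∈ signers) :
      Msg.Contains σ (.update pro g tab)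
  | deep {pro g tab} {v : Val n} {t : ℕ} {s : Fin n} {b : Msg n} {signers : Finset (Fin n)}
      (h : tab v t = Cert.seenAll s b signers) (hb : Msg.Contains σ b) :
      Msg.Contains σ (.update pro g tab)

/-- What is sent in an instance of gradecast: a message, or a message with a signature. -/
inductive Payload (n : ℕ) : Type
  | plain (m : Msg n)
  | signed (m : Msg n) (σ : Sig n)

/-- The signature `σ` occurs in what is sent. -/
def Payload.Contains (σ : Sig n) : Payload n → Prop
  | .plain m => m.Contains σ
  | .signed m τ => σ = τ ∨ m.Contains σ

/-- A packet holds, for each of the `n` parallel gradecast instances (indexed by their source), the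
payloads sent in that instance. A Byzantine sender may send several in one instance. -/
abbrev Packet (n : ℕ) : Type := Fin n → Set (Payload n)

/-- Byzantine participants cannot forge: a signature of a correct participant occurs in a packet of a
Byzantine one only if the signer has itself issued it, in the same round or before. -/
def Unforgeable (F : Finset (Fin n)) (sent : ℕ → Fin n → Fin n → Packet n) : Prop :=
  ∀ r, ∀ b ∈ F, ∀ q s, ∀ x ∈ sent r b q s, ∀ σ : Sig n, x.Contains σ → σ.signer ∉ F →
    ∃ r' ≤ r, ∃ q' s' m, Payload.signed m σ ∈ sent r' σ.signer q' s'

/-! ### Provable gradecast -/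

open Classical in
/-- Select an element of a set, if there is one. -/
def select {α : Type} (S : Set α) : Option α := if h : S.Nonempty then some h.some else none

open Classical in
/-- The sources from which the message `m` was received, in the second round of the instance `s`. -/
def relayers (inbox : Fin n → Packet n) (s : Fin n) (m : Msg n) : Finset (Fin n) :=
  Finset.univ.filter fun q => Payload.plain m ∈ inbox q s

open Classical in
/-- The sources from which the message `m` was received correctly signed, in the third round of the
instance `s` of epoch `ep`. -/
def signersOf (inbox : Fin n → Packet n) (ep : ℕ) (s : Fin n) (m : Msg n) : Finset (Fin n) :=
  Finset.univ.filter fun q => Payload.signed m ⟨q, ep, s, m⟩ ∈ inbox q s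

/-- Select a message with the largest set of sources, provided that it has at least `k` sources. -/
def mostFrequent (sources : Msg n → Finset (Fin n)) (k : ℕ) : Option (Msg n) :=
  select {m | (∀ m', (sources m').card ≤ (sources m).card) ∧ k ≤ (sources m).card}

/-- The outcome of an instance of provable gradecast at one participant. -/
structure Delivery (n : ℕ) where
  msg : Option (Msg n)
  rank : ℕ
  cert : Cert n

open Classical in
/-- The end of the third round of the instance `s` of epoch `ep`. -/
def grade (f : ℕ) (inbox : Fin n → Packet n) (ep : ℕ) (s : Fin n) : Delivery n :=
  match mostFrequent (signersOf inbox ep s) (n - f) with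
  | some m => ⟨some m, 2,
      match select {Q : Finset (Fin n) | Q ⊆ signersOf inbox ep s m ∧ Q.card = n - f} with
      | some Q => .seenAll s m Q
      | none => .bot⟩
  | none =>
    match mostFrequent (signersOf inbox ep s) (f + 1) with
    | some m => ⟨some m, 1, .bot⟩
    | none => ⟨none, 0, .bot⟩

/-! ### The algorithm `GAC_fast` -/

/-- The local state. `td` and `tu` are the thresholds; `first` and `second` hold the messages to be
relayed in the second and the third round of the current gradecasts. -/
structure GacState (n : ℕ) where
  self : Fin n
  input : Val n
  pro : Finset (Val n)
  group : Group
  proofs : Val n → ℕ → Cert n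
  td : ℕ
  tu : ℕ
  first : Fin n → Option (Msg n)
  second : Fin n → Option (Msg n)
  decision : Option (Val n)

/-- The threshold `t_m = t_d + ⌊(t_u - t_d) / 2⌋`. -/
def GacState.tm (x : GacState n) : ℕ := x.td + (x.tu - x.td) / 2

/-- The last epoch. -/
def lastEpoch (f : ℕ) : ℕ := Nat.clog 2 f + 1

/-- The message to be gradecast in epoch `ep`. -/
def GacState.message (x : GacState n) (ep : ℕ) : Msg n :=
  if ep = 0 then .propose x.input else .update x.pro x.group x.proofs

/-- Each epoch takes three rounds, in which all the participants gradecast in parallel. All sends are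
broadcasts, and nothing is sent after the last epoch. -/
def gacSend (f r : ℕ) (x : GacState n) : Packet n := fun s =>
  if lastEpoch f < r / 3 then ∅
  else if r % 3 = 0 then {y | s = x.self ∧ y = .plain (x.message (r / 3))}
  else if r % 3 = 1 then {y | ∃ m, x.first s = some m ∧ y = .plain m}
  else {y | ∃ m, x.second s = some m ∧ y = .signed m ⟨x.self, r / 3, s, m⟩}

open Classical in
/-- The allowed values carried, with an admissibility proof, by the messages that were delivered with
rank at least `c` and whose sender claims to be in the group `g`. -/
def collect (f : ℕ) (P : Fin n → Delivery n) (c : ℕ) (g : Group) : Finset (Val n) :=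
  (allowed n).filter fun v =>
    ∃ q m, (P q).msg = some m ∧ c ≤ (P q).rank ∧ m.group = g ∧ m.Carries (n - f) v

open Classical in
/-- Certificates for the values in `pro`, after an epoch that was started in the group `g` and ended in
the group `g'`, from the deliveries `P` of this epoch. For an earlier epoch in which the group was
classified as slave, a valid certificate contained in a delivered message; if the classification of
this epoch is slave, a seen-all proof of this epoch for a message that carries the value. -/
def newProofs (f : ℕ) (P : Fin n → Delivery n) (pro : Finset (Val n)) (g g' : Group) :
    Val n → ℕ → Cert n := fun v t =>
  if v ∈ pro ∧ g'[t]? = some Role.slave then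
    if t < g.length then
      (select {c | ∃ q m, (P q).msg = some m ∧ m.proofs v t = c ∧
        c.Supports (n - f) v (g.take t)}).getD .bot
    else
      (select {c | ∃ q m, (P q).msg = some m ∧ (P q).rank = 2 ∧ m.group = g ∧
        m.Carries (n - f) v ∧ (P q).cert = c}).getD .bot
  else .bot

/-- The end of epoch `0`: adopt the values seen with rank `2` and set the thresholds. -/
def endEpochZero (f : ℕ) (P : Fin n → Delivery n) (x : GacState n) : GacState n :=
  let V := collect f P 2 x.group
  let g' := x.group ++ [Role.slave]
  { x with
    pro := V
    group := g'
    proofs := newProofs f P V x.group g'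
    td := n - f
    tu := n }

/-- The end of a later epoch: classify, and act as a slave or as a master. -/
def endEpochSucc (f : ℕ) (P : Fin n → Delivery n) (x : GacState n) : GacState n :=
  let V := collect f P 1 x.group
  if V.card ≤ x.tm then
    let g' := x.group ++ [Role.slave]
    { x with
      group := g'
      proofs := newProofs f P x.pro x.group g'
      tu := x.tm }
  else
    let g' := x.group ++ [Role.master]
    { x with
      pro := V
      group := g'
      proofs := newProofs f P V x.group g'
      td := x.tm }

/-- The end of epoch `ep`; the decision, the join of the current values, is taken in the last one. -/
def endEpoch (f ep : ℕ) (P : Fin n → Delivery n) (x : GacState n) : GacState n :=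
  let y := if ep = 0 then endEpochZero f P x else endEpochSucc f P x
  if ep = lastEpoch f then { y with decision := some (y.pro.sup id) } else y

/-- The receive phase of round `r`. -/
def gacReceive (f r : ℕ) (x : GacState n) (inbox : Fin n → Packet n) : GacState n :=
  if lastEpoch f < r / 3 then x
  else if r % 3 = 0 then { x with first := fun s => select {m | Payload.plain m ∈ inbox s s} }
  else if r % 3 = 1 then { x with second := fun s => mostFrequent (relayers inbox s) (n - f) }
  else endEpoch f (r / 3) (grade f inbox (r / 3)) x

/-- The algorithm `GAC_fast` for `n` participants and at most `f` Byzantine ones. -/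
def gacFast (n f : ℕ) : SyncAlg (Fin n) (Val n) (Packet n) (Val n) where
  State := GacState n
  init p v :=
    { self := p, input := v, pro := {v}, group := [], proofs := fun _ _ => .bot, td := 0, tu := n,
      first := fun _ => none, second := fun _ => none, decision := none }
  send r x _ := gacSend f r x
  receive r x inbox := gacReceive f r x inbox
  output x := x.decision

end ByzLA

end

/-!
The algorithm is correct because the size of a set of values locates its holder between two
thresholds that every epoch brings closer together, and because a certificate can only be made of
signatures that force a value on all the correct participants.

*Gradecast.* Two sets of `n - f` participants share a correct one, so all the correct participants
that sign in an instance sign the same message (`Signs.unique`). Hence `n - f` authentic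
signatures on a message, of which more than `f` come from correct participants, make every correct
participant deliver that message (`delivery_of_signers`), and a correct source has its message
delivered with rank `2` (`delivery_of_correct`). All signatures in circulation are authentic:
Byzantine participants cannot forge, and correct ones only forward what they received
(`sound_stateAt`).

*Certificates.* Consequently, a value with a valid seen-all proof of epoch `t` for a group is
collected in epoch `t` by every correct member of that group (`mem_collected_of_supports`). Call a
value admissible for a group if it has this property at every prefix of the group that ends with
`slave` (`admissible`). Correct participants hold valid certificates for all their values
(`valid_stateAt`), so the values they hold are admissible for their group
(`pro_subset_admissible`).

*Thresholds.* A participant holds at least `td` values, and at most `tu` values are admissible for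
its group (`thresholds`): a new slave has itself collected at most `tm` values, among them all
those admissible for its new group, and a new master holds more than `tm` values. After epoch `0`
the gap `tu - td` is `f`, and each later epoch halves it (`tu_sub_td_le`), so that it is at most
`1` when the last epoch starts. That epoch then leaves every participant with exactly the
admissible values of its group (`pro_eq_admissible`).

*Agreement.* Participants that end in the same group therefore decide the same. If the groups of
`p` and `q` part at epoch `t`, with `p` on the side of the slaves, then the values of `p` were
collected by `q` in epoch `t`, and `q`, as a master, has kept all it collected
(`pro_subset_of_split`). Values are never lost (`pro_mono`), which gives inclusivity. For
non-triviality, every value held after epoch `0` was collected in epoch `0` by one fixed correct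
participant, to which each Byzantine source has at most one value delivered (`mem_of_mem_pro`,
`card_byzantineValues_le`).
-/

noncomputable section

namespace ByzLA

variable {n : ℕ}

/-! ### Selection by frequency and the grading of deliveries -/

theorem select_mem {α : Type} {S : Set α} {a : α} (h : select S = some a) : a ∈ S := by
  unfold select at h
  split_ifs at h with hS
  obtain rfl := Option.some.inj h
  exact hS.some_mem

theorem exists_select {α : Type} {S : Set α} (h : S.Nonempty) : ∃ a ∈ S, select S = some a :=
  ⟨h.some, h.some_mem, by simp [select, h]⟩

theorem select_singleton {α : Type} (a : α) : select ({a} : Set α) = some a := by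
  obtain ⟨b, hb, h⟩ := exists_select (Set.singleton_nonempty a)
  rw [h, Set.mem_singleton_iff.mp hb]

theorem le_card_of_mostFrequent {sources : Msg n → Finset (Fin n)} {k : ℕ} {m : Msg n}
    (h : mostFrequent sources k = some m) : k ≤ (sources m).card :=
  (select_mem h).2

/-- Although a Byzantine participant may send infinitely many messages, the numbers of sources are
bounded by `n`, so that a most frequent message exists. -/
theorem exists_mostFrequent {sources : Msg n → Finset (Fin n)} {k : ℕ} {m : Msg n}
    (h : k ≤ (sources m).card) : ∃ m', mostFrequent sources k = some m' := by
  have hfin : (Set.range fun m => (sources m).card).Finite :=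
    (Set.finite_Iic n).subset (by
      rintro _ ⟨m, rfl⟩
      simpa using Finset.card_le_univ (sources m))
  obtain ⟨_, ⟨m', rfl⟩, hmax⟩ := hfin.exists_maximal ⟨_, m, rfl⟩
  have hmax' : ∀ m'', (sources m'').card ≤ (sources m').card := fun m'' =>
    (le_total (sources m'').card (sources m').card).elim id fun hle => hmax ⟨m'', rfl⟩ hle
  obtain ⟨a, -, ha⟩ := exists_select
    (S := {m | (∀ m', (sources m').card ≤ (sources m).card) ∧ k ≤ (sources m).card})
    ⟨m', hmax', h.trans (hmax' m)⟩
  exact ⟨a, ha⟩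

theorem mostFrequent_eq {sources : Msg n → Finset (Fin n)} {k : ℕ} {m : Msg n}
    (h : k ≤ (sources m).card) (huniq : ∀ m', k ≤ (sources m').card → m' = m) :
    mostFrequent sources k = some m := by
  obtain ⟨m', hm'⟩ := exists_mostFrequent h
  rw [hm', huniq m' (le_card_of_mostFrequent hm')]

section Grade

variable {f ep : ℕ} {inbox : Fin n → Packet n} {s : Fin n} {m : Msg n}

theorem mem_relayers {q : Fin n} : q ∈ relayers inbox s m ↔ Payload.plain m ∈ inbox q s := by
  simp [relayers]

theorem mem_signersOf {q : Fin n} :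
    q ∈ signersOf inbox ep s m ↔ Payload.signed m ⟨q, ep, s, m⟩ ∈ inbox q s := by
  simp [signersOf]

theorem lt_card_signersOf_of_grade (hn : 3 * f < n) (h : (grade f inbox ep s).msg = some m) :
    f < (signersOf inbox ep s m).card := by
  unfold grade at h
  split at h
  · obtain rfl := Option.some.inj h
    have := le_card_of_mostFrequent ‹_›
    omega
  · split at h
    · obtain rfl := Option.some.inj h
      have := le_card_of_mostFrequent ‹_›
      omega
    · simp at h

theorem one_le_rank_of_grade (h : (grade f inbox ep s).msg = some m) :
    1 ≤ (grade f inbox ep s).rank := by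
  unfold grade at h ⊢
  split at h
  · simp
  · split at h
    · simp
    · simp at h

theorem grade_eq_some (hn : 3 * f < n) (h : f < (signersOf inbox ep s m).card)
    (huniq : ∀ m', f < (signersOf inbox ep s m').card → m' = m) :
    (grade f inbox ep s).msg = some m := by
  unfold grade
  split
  · have := le_card_of_mostFrequent ‹_›
    exact congrArg some (huniq _ (by omega))
  · rw [mostFrequent_eq (k := f + 1) h huniq]

theorem rank_grade_eq_two (h : n - f ≤ (signersOf inbox ep s m).card) :
    (grade f inbox ep s).rank = 2 := by
  obtain ⟨m', hm'⟩ := exists_mostFrequent h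
  simp [grade, hm']

/-- The certificate of an instance is either empty or a seen-all proof for the delivered message,
made of received signatures. -/
theorem cert_grade :
    (grade f inbox ep s).cert = .bot ∨ ∃ m Q, (grade f inbox ep s).msg = some m ∧
      (grade f inbox ep s).cert = .seenAll s m Q ∧ Q ⊆ signersOf inbox ep s m := by
  unfold grade
  split
  · split
    · have hQ := select_mem ‹_›
      exact .inr ⟨_, _, rfl, rfl, hQ.1⟩
    · exact .inl rfl
  · split <;> exact .inl rfl

theorem exists_cert_grade (h : (grade f inbox ep s).msg = some m)
    (hr : (grade f inbox ep s).rank = 2) :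
    ∃ Q : Finset (Fin n), Q.card = n - f ∧ (grade f inbox ep s).cert = .seenAll s m Q := by
  unfold grade at h hr ⊢
  split at h
  · obtain rfl := Option.some.inj h
    obtain ⟨Q, hQ⟩ := Finset.exists_subset_card_eq (le_card_of_mostFrequent ‹_›)
    obtain ⟨Q', hQ', hsel⟩ := exists_select
      (S := {Q : Finset (Fin n) | Q ⊆ signersOf inbox ep s _ ∧ Q.card = n - f}) ⟨Q, hQ⟩
    exact ⟨Q', hQ'.2, by simp only [hsel]⟩
  · split at h
    · simp [*] at hr
    · simp at h

end Grade

/-! ### Soundness of signatures -/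

/-- All the signatures that occur in a message satisfy `I`. -/
def Msg.Sound (I : Sig n → Prop) (m : Msg n) : Prop := ∀ σ, m.Contains σ → I σ

/-- All the signatures that occur in a certificate of epoch `t` satisfy `I`. -/
def Cert.Sound (I : Sig n → Prop) (t : ℕ) (c : Cert n) : Prop :=
  ∀ s b Q, c = .seenAll s b Q → b.Sound I ∧ ∀ q ∈ Q, I ⟨q, t, s, b⟩

/-- All the signatures that occur in a packet satisfy `I`. -/
def Packet.Sound (I : Sig n → Prop) (k : Packet n) : Prop :=
  ∀ s, ∀ x ∈ k s, ∀ σ, x.Contains σ → I σ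

section Sound

variable {I : Sig n → Prop} {f ep : ℕ} {inbox : Fin n → Packet n}

theorem Cert.sound_bot (t : ℕ) : (Cert.bot : Cert n).Sound I t := by
  intro s b Q h
  cases h

theorem Msg.sound_propose (v : Val n) : (Msg.propose v).Sound I := by
  intro σ h
  cases h

theorem Msg.sound_update {pro : Finset (Val n)} {g : Group} {tab : Val n → ℕ → Cert n}
    (h : ∀ v t, (tab v t).Sound I t) : (Msg.update pro g tab).Sound I := by
  intro σ hσ
  cases hσ with
  | here h1 h2 => exact (h _ _ _ _ _ h1).2 _ h2
  | deep h1 h2 => exact (h _ _ _ _ _ h1).1 _ h2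

theorem Msg.Sound.proofs {m : Msg n} (h : m.Sound I) (v : Val n) (t : ℕ) :
    (m.proofs v t).Sound I t := by
  cases m with
  | propose w => exact Cert.sound_bot t
  | update pro g tab =>
    intro s b Q hc
    exact ⟨fun σ hσ => h σ (.deep hc hσ), fun q hq => h _ (.here (σ := ⟨q, t, s, b⟩) hc hq)⟩

theorem sound_of_grade (hn : 3 * f < n) (hin : ∀ q, (inbox q).Sound I) {s : Fin n} {m : Msg n}
    (h : (grade f inbox ep s).msg = some m) : m.Sound I := by
  have hpos : 0 < (signersOf inbox ep s m).card := (lt_card_signersOf_of_grade hn h).pos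
  obtain ⟨q, hq⟩ := Finset.card_pos.mp hpos
  intro σ hσ
  exact hin q s _ (mem_signersOf.mp hq) σ (.inr hσ)

theorem sound_cert_of_grade (hn : 3 * f < n) (hin : ∀ q, (inbox q).Sound I) (s : Fin n) :
    ((grade f inbox ep s).cert).Sound I ep := by
  rcases cert_grade (f := f) (ep := ep) (inbox := inbox) (s := s) with h | ⟨m, Q, hm, hc, hQ⟩
  · rw [h]
    exact Cert.sound_bot ep
  · rw [hc]
    intro s' b Q' h
    obtain ⟨rfl, rfl, rfl⟩ := Cert.seenAll.inj h
    refine ⟨sound_of_grade hn hin hm, fun q hq => ?_⟩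
    exact hin q s _ (mem_signersOf.mp (hQ hq)) _ (.inl rfl)

theorem sound_newProofs (hn : 3 * f < n) (hin : ∀ q, (inbox q).Sound I) {pro : Finset (Val n)}
    {g g' : Group} (hg : g.length = ep) (hg' : g'.length ≤ ep + 1) (v : Val n) (t : ℕ) :
    (newProofs f (grade f inbox ep) pro g g' v t).Sound I t := by
  unfold newProofs
  split_ifs with h1 h2
  · rcases hsel : select _ with _ | c
    · exact Cert.sound_bot t
    · obtain ⟨q, m, hm, rfl, -⟩ := select_mem hsel
      exact (sound_of_grade hn hin hm).proofs v t
  · have ht : t = ep := by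
      obtain ⟨h, -⟩ := List.getElem?_eq_some_iff.mp h1.2
      omega
    subst ht
    rcases hsel : select _ with _ | c
    · exact Cert.sound_bot t
    · obtain ⟨q, m, -, -, -, -, rfl⟩ := select_mem hsel
      exact sound_cert_of_grade hn hin q
  · exact Cert.sound_bot t

/-- All the signatures that occur in the messages and certificates held in a state satisfy `I`. -/
structure GacState.Sound (I : Sig n → Prop) (x : GacState n) : Prop where
  first : ∀ s m, x.first s = some m → m.Sound I
  second : ∀ s m, x.second s = some m → m.Sound I
  proofs : ∀ v t, (x.proofs v t).Sound I t

theorem GacState.Sound.endEpoch {x : GacState n} (hx : x.Sound I) (hn : 3 * f < n)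
    (hin : ∀ q, (inbox q).Sound I) (hg : x.group.length = ep) :
    (endEpoch f ep (grade f inbox ep) x).Sound I := by
  have key : (if ep = 0 then endEpochZero f (grade f inbox ep) x
      else endEpochSucc f (grade f inbox ep) x).Sound I := by
    split_ifs
    · exact ⟨hx.first, hx.second, sound_newProofs hn hin hg (by simp [hg])⟩
    · unfold endEpochSucc
      dsimp only
      split_ifs
      · exact ⟨hx.first, hx.second, sound_newProofs hn hin hg (by simp [hg])⟩
      · exact ⟨hx.first, hx.second, sound_newProofs hn hin hg (by simp [hg])⟩
  unfold ByzLA.endEpoch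
  dsimp only
  split_ifs at key ⊢ <;> exact ⟨key.first, key.second, key.proofs⟩

end Sound

/-! ### Executions -/

section Execution

variable {n : ℕ} (f : ℕ) (F : Finset (Fin n)) (pro : Fin n → Val n)
  (adv : ℕ → Fin n → Fin n → Packet n)

/-- The state of `p` after `r` rounds. Only for `p ∉ F` is it the state that determines what `p`
sends. -/
def stateAt (r : ℕ) (p : Fin n) : GacState n := (gacFast n f).run F pro adv r p

/-- The packets that `p` receives in round `r`, indexed by their sender. -/
def inboxAt (r : ℕ) (p q : Fin n) : Packet n := (gacFast n f).sent F pro adv r q p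

/-- The outcome at `p` of the gradecasts of epoch `e`, indexed by their source. -/
def delivery (e : ℕ) (p : Fin n) : Fin n → Delivery n :=
  grade f (inboxAt f F pro adv (3 * e + 2) p) e

/-- The set `V'` of `p` in epoch `e`: the values carried by the messages delivered with rank at least
`1` from senders that claim to be in the group of `p`. -/
def collected (e : ℕ) (p : Fin n) : Finset (Val n) :=
  collect f (delivery f F pro adv e p) 1 (stateAt f F pro adv (3 * e) p).group

/-- The participant `p`, if correct, signs the message `m` in the instance of the source `s` of epoch
`e`. Nothing is sent after the last epoch. -/
def Signs (e : ℕ) (p s : Fin n) (m : Msg n) : Prop :=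
  e ≤ lastEpoch f ∧ (stateAt f F pro adv (3 * e + 2) p).second s = some m

/-- A signature is authentic if its signer is Byzantine or has issued it. -/
def Authentic (σ : Sig n) : Prop :=
  σ.signer ∉ F → Signs f F pro adv σ.epoch σ.signer σ.source σ.body

variable {f F pro adv}

theorem stateAt_succ (r : ℕ) (p : Fin n) : stateAt f F pro adv (r + 1) p =
    gacReceive f r (stateAt f F pro adv r p) (inboxAt f F pro adv r p) := rfl

theorem inboxAt_of_notMem {q : Fin n} (hq : q ∉ F) (r : ℕ) (p : Fin n) :
    inboxAt f F pro adv r p q = gacSend f r (stateAt f F pro adv r q) := by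
  simp [inboxAt, SyncAlg.sent, SyncAlg.deliver, hq, gacFast, stateAt]

/-- After the first round of an epoch. -/
theorem stateAt_epoch_one {e : ℕ} (he : e ≤ lastEpoch f) (p : Fin n) :
    stateAt f F pro adv (3 * e + 1) p = { stateAt f F pro adv (3 * e) p with
      first := fun s => select {m | Payload.plain m ∈ inboxAt f F pro adv (3 * e) p s s} } := by
  have h1 : 3 * e / 3 = e := by omega
  have h2 : 3 * e % 3 = 0 := by omega
  rw [stateAt_succ, gacReceive, h1, h2, if_neg he.not_gt, if_pos rfl]

/-- After the second round of an epoch. -/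
theorem stateAt_epoch_two {e : ℕ} (he : e ≤ lastEpoch f) (p : Fin n) :
    stateAt f F pro adv (3 * e + 2) p = { stateAt f F pro adv (3 * e + 1) p with
      second := fun s =>
        mostFrequent (relayers (inboxAt f F pro adv (3 * e + 1) p) s) (n - f) } := by
  have h1 : (3 * e + 1) / 3 = e := by omega
  have h2 : (3 * e + 1) % 3 = 1 := by omega
  rw [stateAt_succ, gacReceive, h1, h2, if_neg he.not_gt, if_neg one_ne_zero, if_pos rfl]

/-- After the third round of an epoch. -/
theorem stateAt_epoch_three {e : ℕ} (he : e ≤ lastEpoch f) (p : Fin n) :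
    stateAt f F pro adv (3 * (e + 1)) p =
      endEpoch f e (delivery f F pro adv e p) (stateAt f F pro adv (3 * e + 2) p) := by
  have h1 : (3 * e + 2) / 3 = e := by omega
  have h2 : (3 * e + 2) % 3 = 2 := by omega
  rw [show 3 * (e + 1) = 3 * e + 2 + 1 by ring, stateAt_succ, gacReceive, h1, h2,
    if_neg he.not_gt, if_neg two_ne_zero, if_neg (by norm_num)]
  rfl

theorem stateAt_of_lastEpoch_lt {r : ℕ} (hr : 3 * (lastEpoch f + 1) ≤ r) (p : Fin n) :
    stateAt f F pro adv r p = stateAt f F pro adv (3 * (lastEpoch f + 1)) p := by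
  induction r, hr using Nat.le_induction with
  | base => rfl
  | succ r hr ih => rw [stateAt_succ, gacReceive, if_pos (by omega), ih]

theorem gacSend_zero {e : ℕ} (he : e ≤ lastEpoch f) (x : GacState n) (s : Fin n) :
    gacSend f (3 * e) x s = {y | s = x.self ∧ y = .plain (x.message e)} := by
  have h1 : 3 * e / 3 = e := by omega
  have h2 : 3 * e % 3 = 0 := by omega
  rw [gacSend, h1, h2, if_neg he.not_gt, if_pos rfl]

theorem gacSend_one {e : ℕ} (he : e ≤ lastEpoch f) (x : GacState n) (s : Fin n) :
    gacSend f (3 * e + 1) x s = {y | ∃ m, x.first s = some m ∧ y = .plain m} := by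
  have h1 : (3 * e + 1) / 3 = e := by omega
  have h2 : (3 * e + 1) % 3 = 1 := by omega
  rw [gacSend, h1, h2, if_neg he.not_gt, if_neg one_ne_zero, if_pos rfl]

theorem gacSend_two {e : ℕ} (he : e ≤ lastEpoch f) (x : GacState n) (s : Fin n) :
    gacSend f (3 * e + 2) x s =
      {y | ∃ m, x.second s = some m ∧ y = .signed m ⟨x.self, e, s, m⟩} := by
  have h1 : (3 * e + 2) / 3 = e := by omega
  have h2 : (3 * e + 2) % 3 = 2 := by omega
  rw [gacSend, h1, h2, if_neg he.not_gt, if_neg two_ne_zero, if_neg (by norm_num)]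

theorem self_endEpoch (e : ℕ) (P : Fin n → Delivery n) (x : GacState n) :
    (endEpoch f e P x).self = x.self := by
  unfold endEpoch endEpochZero endEpochSucc
  dsimp only
  split_ifs <;> rfl

theorem self_stateAt (r : ℕ) (p : Fin n) : (stateAt f F pro adv r p).self = p := by
  induction r with
  | zero => rfl
  | succ r ih =>
    rw [stateAt_succ, gacReceive]
    split_ifs
    · exact ih
    · exact ih
    · exact ih
    · rw [self_endEpoch, ih]

theorem length_group_endEpoch (e : ℕ) (P : Fin n → Delivery n) (x : GacState n) :
    (endEpoch f e P x).group.length = x.group.length + 1 := by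
  unfold endEpoch endEpochZero endEpochSucc
  dsimp only
  split_ifs <;> simp

theorem length_group_stateAt {r : ℕ} (hr : r / 3 ≤ lastEpoch f + 1) (p : Fin n) :
    (stateAt f F pro adv r p).group.length = r / 3 := by
  induction r with
  | zero => rfl
  | succ r ih =>
    have ih := ih (by omega)
    rw [stateAt_succ, gacReceive]
    split_ifs
    · rw [ih]; omega
    · exact ih.trans (by omega)
    · exact ih.trans (by omega)
    · rw [length_group_endEpoch, ih]
      omega

/-! ### Authenticity of all the signatures in circulation -/

theorem sound_gacSend {r : ℕ} {p : Fin n}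
    (hx : (stateAt f F pro adv r p).Sound (Authentic f F pro adv)) :
    (gacSend f r (stateAt f F pro adv r p)).Sound (Authentic f F pro adv) := by
  intro s x hxs σ hσ
  rw [gacSend] at hxs
  split_ifs at hxs with h1 h2 h3
  · exact hxs.elim
  · obtain ⟨-, rfl⟩ := hxs
    revert hσ
    change (GacState.message _ _).Contains σ → _
    unfold GacState.message
    split_ifs
    · exact Msg.sound_propose _ σ
    · exact Msg.sound_update hx.proofs σ
  · obtain ⟨m, hm, rfl⟩ := hxs
    exact hx.first s m hm σ hσ
  · obtain ⟨m, hm, rfl⟩ := hxs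
    rcases hσ with rfl | hσ
    · intro _
      refine ⟨not_lt.mp h1, ?_⟩
      dsimp only
      rw [self_stateAt, show 3 * (r / 3) + 2 = r by omega]
      exact hm
    · exact hx.second s m hm σ hσ

/-- A correct participant never sends an inauthentic signature, because it only forwards what it
received; for a Byzantine one this is the unforgeability of signatures. -/
theorem sound_sent (hunf : Unforgeable F ((gacFast n f).sent F pro adv)) {r : ℕ}
    (hx : ∀ p ∉ F, (stateAt f F pro adv r p).Sound (Authentic f F pro adv)) (p q : Fin n) :
    (inboxAt f F pro adv r p q).Sound (Authentic f F pro adv) := by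
  by_cases hq : q ∈ F
  · intro s x hxs σ hσ hsig
    obtain ⟨r', -, q', s', m, hm⟩ := hunf r q hq p s x hxs σ hσ hsig
    change _ ∈ inboxAt f F pro adv r' q' σ.signer s' at hm
    rw [inboxAt_of_notMem hsig, gacSend] at hm
    split_ifs at hm with h1 h2 h3
    · exact hm.elim
    · simp at hm
    · simp at hm
    · obtain ⟨m', hm', heq⟩ := hm
      obtain ⟨rfl, hσ'⟩ := Payload.signed.inj heq
      have he : σ.epoch = r' / 3 := by rw [hσ']
      have hs : σ.source = s' := by rw [hσ']
      have hb : σ.body = m := by rw [hσ']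
      refine ⟨by omega, ?_⟩
      rw [he, hs, hb, show 3 * (r' / 3) + 2 = r' by omega]
      exact hm'
  · rw [inboxAt_of_notMem hq]
    exact sound_gacSend (hx q hq)

theorem sound_stateAt (hn : 3 * f < n) (hunf : Unforgeable F ((gacFast n f).sent F pro adv))
    (r : ℕ) : ∀ p ∉ F, (stateAt f F pro adv r p).Sound (Authentic f F pro adv) := by
  induction r with
  | zero =>
    refine fun p _ => ⟨fun s m h => ?_, fun s m h => ?_, fun v t => Cert.sound_bot t⟩
    · cases h
    · cases h
  | succ r ih =>
    intro p hp
    have hin := sound_sent hunf ih p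
    have hx := ih p hp
    rw [stateAt_succ, gacReceive]
    split_ifs with h1 h2 h3
    · exact hx
    · refine ⟨fun s m h σ hσ => ?_, hx.second, hx.proofs⟩
      have hm := select_mem (S := {m | Payload.plain m ∈ inboxAt f F pro adv r p s s}) h
      exact hin s s _ hm σ hσ
    · refine ⟨hx.first, fun s m h σ hσ => ?_, hx.proofs⟩
      have hpos : 0 < (relayers (inboxAt f F pro adv r p) s m).card :=
        lt_of_lt_of_le (by omega) (le_card_of_mostFrequent h)
      obtain ⟨q, hq⟩ := Finset.card_pos.mp hpos
      exact hin q s _ (mem_relayers.mp hq) σ hσ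
    · exact hx.endEpoch hn hin (length_group_stateAt (by omega) p)

/-! ### Properties of provable gradecast -/

theorem mem_relayers_iff {e : ℕ} (he : e ≤ lastEpoch f) {p q s : Fin n} (hq : q ∉ F) {m : Msg n} :
    q ∈ relayers (inboxAt f F pro adv (3 * e + 1) p) s m ↔
      (stateAt f F pro adv (3 * e + 1) q).first s = some m := by
  rw [mem_relayers, inboxAt_of_notMem hq, gacSend_one he]
  simp

theorem mem_signersOf_iff {e : ℕ} (he : e ≤ lastEpoch f) {p q s : Fin n} (hq : q ∉ F)
    {m : Msg n} :
    q ∈ signersOf (inboxAt f F pro adv (3 * e + 2) p) e s m ↔ Signs f F pro adv e q s m := by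
  rw [mem_signersOf, inboxAt_of_notMem hq, gacSend_two he]
  simp [self_stateAt, Signs, he]

/-- A set with more than `f` members has a correct member. -/
theorem exists_notMem_of_lt_card {F S : Finset (Fin n)} (hF : F.card ≤ f) (h : f < S.card) :
    ∃ p ∈ S, p ∉ F := by
  by_contra! hcon
  exact absurd (Finset.card_le_card hcon) (by omega)

/-- Two sets of at least `n - f` participants have a correct participant in common. -/
theorem exists_common_notMem {F S S' : Finset (Fin n)} (hn : 3 * f < n) (hF : F.card ≤ f)
    (h : n - f ≤ S.card) (h' : n - f ≤ S'.card) : ∃ p ∈ S, p ∈ S' ∧ p ∉ F := by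
  have hcard : f < (S ∩ S').card := by
    have h1 := Finset.card_union_add_card_inter S S'
    have h2 := Finset.card_le_univ (S ∪ S')
    rw [Fintype.card_fin] at h2
    omega
  obtain ⟨p, hp, hpF⟩ := exists_notMem_of_lt_card hF hcard
  exact ⟨p, (Finset.mem_inter.mp hp).1, (Finset.mem_inter.mp hp).2, hpF⟩

/-- All the correct participants that sign in an instance sign the same message, since each of them
saw it relayed by `n - f` participants, and a correct participant relays at most one message. -/
theorem Signs.unique (hn : 3 * f < n) (hF : F.card ≤ f) {e : ℕ} {p p' s : Fin n} {m m' : Msg n}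
    (h : Signs f F pro adv e p s m) (h' : Signs f F pro adv e p' s m') : m = m' := by
  obtain ⟨he, h⟩ := h
  replace h' := h'.2
  rw [stateAt_epoch_two he] at h h'
  obtain ⟨q, hq, hq', hqF⟩ := exists_common_notMem hn hF (le_card_of_mostFrequent h)
    (le_card_of_mostFrequent h')
  rw [mem_relayers_iff he hqF] at hq hq'
  exact Option.some.inj (hq.symm.trans hq')

/-- If, among some `n - f` participants, all the correct ones sign a message, then everyone delivers
it: more than `f` of them are correct, and any competing message has only Byzantine signers. -/
theorem delivery_of_signers (hn : 3 * f < n) (hF : F.card ≤ f) {e : ℕ} {s : Fin n} {m : Msg n}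
    {Q : Finset (Fin n)} (hQ : n - f ≤ Q.card) (h : ∀ q ∈ Q, q ∉ F → Signs f F pro adv e q s m)
    (p : Fin n) : (delivery f F pro adv e p s).msg = some m := by
  have hcorrect : f < (Q \ F).card := by
    have := Finset.le_card_sdiff F Q
    omega
  obtain ⟨q₀, hq₀, hq₀F⟩ := exists_notMem_of_lt_card hF (show f < Q.card by omega)
  have h₀ := h q₀ hq₀ hq₀F
  have he := h₀.1
  refine grade_eq_some hn (hcorrect.trans_le (Finset.card_le_card fun q hq => ?_)) ?_
  · rw [Finset.mem_sdiff] at hq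
    exact (mem_signersOf_iff he hq.2).mpr (h q hq.1 hq.2)
  · intro m' hm'
    obtain ⟨q', hq', hq'F⟩ := exists_notMem_of_lt_card hF hm'
    exact ((mem_signersOf_iff he hq'F).mp hq').unique hn hF h₀

theorem le_card_compl (hF : F.card ≤ f) : n - f ≤ (Fᶜ).card := by
  rw [Finset.card_compl, Fintype.card_fin]
  omega

/-- The messages of correct sources are delivered with rank `2`. -/
theorem delivery_of_correct (hn : 3 * f < n) (hF : F.card ≤ f) {e : ℕ} (he : e ≤ lastEpoch f)
    {s : Fin n} (hs : s ∉ F) (p : Fin n) :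
    (delivery f F pro adv e p s).msg = some ((stateAt f F pro adv (3 * e) s).message e) ∧
      (delivery f F pro adv e p s).rank = 2 := by
  set m := (stateAt f F pro adv (3 * e) s).message e
  have hfirst : ∀ q, (stateAt f F pro adv (3 * e + 1) q).first s = some m := by
    intro q
    rw [stateAt_epoch_one he]
    dsimp only
    rw [inboxAt_of_notMem hs, gacSend_zero he]
    simp only [Set.mem_ofPred_eq, self_stateAt, true_and, Payload.plain.injEq]
    exact select_singleton m
  have hsigns : ∀ q, Signs f F pro adv e q s m := by
    refine fun q => ⟨he, ?_⟩
    rw [stateAt_epoch_two he]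
    refine mostFrequent_eq ((le_card_compl hF).trans (Finset.card_le_card fun q' hq' => ?_)) ?_
    · exact (mem_relayers_iff he (Finset.mem_compl.mp hq')).mpr (hfirst q')
    · intro m' hm'
      have hlt : f < (relayers (inboxAt f F pro adv (3 * e + 1) q) s m').card :=
        lt_of_lt_of_le (by omega) hm'
      obtain ⟨q', hq', hq'F⟩ := exists_notMem_of_lt_card hF hlt
      exact Option.some.inj (((mem_relayers_iff he hq'F).mp hq').symm.trans (hfirst q'))
  refine ⟨delivery_of_signers hn hF (le_card_compl hF) (fun q _ _ => hsigns q) p, ?_⟩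
  refine rank_grade_eq_two (m := m) ((le_card_compl hF).trans (Finset.card_le_card fun q hq => ?_))
  exact (mem_signersOf_iff he (Finset.mem_compl.mp hq)).mpr (hsigns q)

end Execution

/-! ### Admissible values -/

section Carries

variable {n k : ℕ} {v : Val n} {m : Msg n}

theorem carries_update {V : Finset (Val n)} {g : Group} {tab : Val n → ℕ → Cert n} :
    (Msg.update V g tab).Carries k v ↔ g ≠ [] ∧ v ∈ V ∧
      ∀ t, g[t]? = some Role.slave → (tab v t).Supports k v (g.take t) := by
  rw [Msg.Carries]

theorem eq_propose_of_carries (hg : m.group = []) (h : m.Carries k v) : m = .propose v := by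
  cases m with
  | propose w =>
    rw [Msg.Carries] at h
    rw [h]
  | update V g tab => exact absurd hg (carries_update.mp h).1

theorem supports_of_carries (h : m.Carries k v) {t : ℕ}
    (ht : m.group[t]? = some Role.slave) : (m.proofs v t).Supports k v (m.group.take t) := by
  cases m with
  | propose w => simp [Msg.group] at ht
  | update V g tab => exact (carries_update.mp h).2.2 t ht

theorem exists_of_supports {g : Group} {c : Cert n} (h : c.Supports k v g) :
    ∃ s b Q, c = .seenAll s b Q ∧ k ≤ Q.card ∧ b.group = g ∧ b.Carries k v := by
  cases c with
  | bot =>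
    rw [Cert.Supports] at h
    exact h.elim
  | seenAll s b Q =>
    rw [Cert.Supports] at h
    exact ⟨s, b, Q, rfl, h⟩

theorem supports_seenAll {s : Fin n} {Q : Finset (Fin n)} (hQ : k ≤ Q.card)
    (h : m.Carries k v) : (Cert.seenAll s m Q).Supports k v m.group := by
  rw [Cert.Supports]
  exact ⟨hQ, rfl, h⟩

theorem card_allowed_le : (allowed n).card ≤ n :=
  Finset.card_image_le.trans (by simp)

theorem mem_collect {f : ℕ} {P : Fin n → Delivery n} {c : ℕ} {g : Group} :
    v ∈ collect f P c g ↔ v ∈ allowed n ∧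
      ∃ q m, (P q).msg = some m ∧ c ≤ (P q).rank ∧ m.group = g ∧ m.Carries (n - f) v := by
  simp [collect]

/-- The certificates kept after an epoch are valid, as soon as the deliveries of the epoch hold
certificates for the earlier epochs and, for a slave, a message of the group seen with rank `2`. -/
theorem supports_newProofs {f ep : ℕ} {inbox : Fin n → Packet n} {V : Finset (Val n)}
    {g : Group} {ρ : Role} (hv : v ∈ V)
    (hold : ∀ t, g[t]? = some Role.slave → ∃ q m, (grade f inbox ep q).msg = some m ∧
      (m.proofs v t).Supports (n - f) v (g.take t))
    (hnew : ρ = .slave → ∃ q m, (grade f inbox ep q).msg = some m ∧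
      (grade f inbox ep q).rank = 2 ∧ m.group = g ∧ m.Carries (n - f) v)
    {t : ℕ} (ht : (g ++ [ρ])[t]? = some Role.slave) :
    (newProofs f (grade f inbox ep) V g (g ++ [ρ]) v t).Supports (n - f) v
      ((g ++ [ρ]).take t) := by
  rw [newProofs, if_pos ⟨hv, ht⟩]
  split_ifs with hlt
  · rw [List.take_append_of_le_length hlt.le]
    rw [List.getElem?_append_left hlt] at ht
    obtain ⟨q, m, hm, hs⟩ := hold t ht
    obtain ⟨c, ⟨-, -, -, -, hc⟩, hsel⟩ := exists_select
      (S := {c | ∃ q m, (grade f inbox ep q).msg = some m ∧ m.proofs v t = c ∧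
        c.Supports (n - f) v (g.take t)}) ⟨_, q, m, hm, rfl, hs⟩
    rw [hsel]
    exact hc
  · have htg : t = g.length := by
      obtain ⟨h, -⟩ := List.getElem?_eq_some_iff.mp ht
      rw [List.length_append, List.length_singleton] at h
      omega
    subst htg
    rw [List.take_append_of_le_length le_rfl, List.take_length]
    rw [List.getElem?_concat_length] at ht
    obtain ⟨q, m, hm⟩ := hnew (Option.some.inj ht)
    obtain ⟨c, ⟨q', m', hm', hr', hg', hc', rfl⟩, hsel⟩ := exists_select
      (S := {c | ∃ q m, (grade f inbox ep q).msg = some m ∧ (grade f inbox ep q).rank = 2 ∧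
        m.group = g ∧ m.Carries (n - f) v ∧ (grade f inbox ep q).cert = c})
      ⟨_, q, m, hm.1, hm.2.1, hm.2.2.1, hm.2.2.2, rfl⟩
    rw [hsel]
    obtain ⟨Q, hQ, hcert⟩ := exists_cert_grade hm' hr'
    rw [Option.getD_some, hcert, ← hg']
    exact supports_seenAll hQ.ge hc'

end Carries

/-! ### The course of an epoch -/

section Epoch

variable {n f : ℕ} {F : Finset (Fin n)} {pro : Fin n → Val n}
  {adv : ℕ → Fin n → Fin n → Packet n}

theorem lastEpoch_pos : 0 < lastEpoch f := Nat.succ_pos _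

theorem exists_stateAt_epoch_eq {e : ℕ} (he : e ≤ lastEpoch f) (p : Fin n) :
    ∃ a b, stateAt f F pro adv (3 * e + 2) p =
      { stateAt f F pro adv (3 * e) p with first := a, second := b } := by
  rw [stateAt_epoch_two he, stateAt_epoch_one he]
  exact ⟨_, _, rfl⟩

theorem stateAt_epoch_zero (p : Fin n) :
    (stateAt f F pro adv (3 * (0 + 1)) p).pro = collect f (delivery f F pro adv 0 p) 2 [] ∧
    (stateAt f F pro adv (3 * (0 + 1)) p).group = [Role.slave] ∧
    (stateAt f F pro adv (3 * (0 + 1)) p).proofs =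
      newProofs f (delivery f F pro adv 0 p) (collect f (delivery f F pro adv 0 p) 2 []) []
        ([] ++ [Role.slave]) ∧
    (stateAt f F pro adv (3 * (0 + 1)) p).td = n - f ∧
    (stateAt f F pro adv (3 * (0 + 1)) p).tu = n := by
  obtain ⟨a, b, hab⟩ := exists_stateAt_epoch_eq (F := F) (pro := pro) (adv := adv)
    (lastEpoch_pos (f := f)).le p
  rw [stateAt_epoch_three lastEpoch_pos.le, hab]
  unfold endEpoch
  rw [if_pos rfl, if_neg lastEpoch_pos.ne]
  exact ⟨rfl, rfl, rfl, rfl, rfl⟩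

/-- The effect of an epoch `e ≥ 1`, according to the classification. -/
theorem stateAt_epoch_succ {e : ℕ} (h1 : 1 ≤ e) (he : e ≤ lastEpoch f) (p : Fin n) :
    let x := stateAt f F pro adv (3 * e) p
    let y := stateAt f F pro adv (3 * (e + 1)) p
    let W := collected f F pro adv e p
    (W.card ≤ x.tm ∧ y.pro = x.pro ∧ y.group = x.group ++ [Role.slave] ∧
      y.proofs = newProofs f (delivery f F pro adv e p) x.pro x.group
        (x.group ++ [Role.slave]) ∧ y.td = x.td ∧ y.tu = x.tm) ∨
    (x.tm < W.card ∧ y.pro = W ∧ y.group = x.group ++ [Role.master] ∧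
      y.proofs = newProofs f (delivery f F pro adv e p) W x.group
        (x.group ++ [Role.master]) ∧ y.td = x.tm ∧ y.tu = x.tu) := by
  intro x y W
  obtain ⟨a, b, hab⟩ := exists_stateAt_epoch_eq (F := F) (pro := pro) (adv := adv) he p
  obtain ⟨z, hz⟩ : ∃ z, z = endEpochSucc f (delivery f F pro adv e p)
    { x with first := a, second := b } := ⟨_, rfl⟩
  have hy : y = if e = lastEpoch f then { z with decision := some (z.pro.sup id) } else z := by
    have h : y = endEpoch f e (delivery f F pro adv e p) { x with first := a, second := b } := by
      rw [← hab]
      exact stateAt_epoch_three he p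
    rw [h, endEpoch, if_neg (show e ≠ 0 by omega), ← hz]
  obtain ⟨hV, hg, hpr, htd, htu⟩ : y.pro = z.pro ∧ y.group = z.group ∧ y.proofs = z.proofs ∧
      y.td = z.td ∧ y.tu = z.tu := by
    rw [hy]
    split_ifs <;> exact ⟨rfl, rfl, rfl, rfl, rfl⟩
  rw [hV, hg, hpr, htd, htu]
  unfold endEpochSucc at hz
  change z = if W.card ≤ x.tm then _ else _ at hz
  rcases le_or_gt W.card x.tm with hW | hW
  · rw [if_pos hW] at hz
    rw [hz]
    exact .inl ⟨hW, rfl, rfl, rfl, rfl, rfl⟩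
  · rw [if_neg hW.not_ge] at hz
    rw [hz]
    exact .inr ⟨hW, rfl, rfl, rfl, rfl, rfl⟩

theorem group_stateAt_succ {e : ℕ} (he : e ≤ lastEpoch f) (p : Fin n) :
    ∃ ρ, (stateAt f F pro adv (3 * (e + 1)) p).group =
      (stateAt f F pro adv (3 * e) p).group ++ [ρ] := by
  rcases e.eq_zero_or_pos with rfl | h1
  · exact ⟨_, (stateAt_epoch_zero p).2.1⟩
  · rcases stateAt_epoch_succ (F := F) (pro := pro) (adv := adv) h1 he p with h | h
    · exact ⟨_, h.2.2.1⟩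
    · exact ⟨_, h.2.2.1⟩

theorem length_group {e : ℕ} (he : e ≤ lastEpoch f + 1) (p : Fin n) :
    (stateAt f F pro adv (3 * e) p).group.length = e := by
  rw [length_group_stateAt (by omega)]
  omega

theorem take_group {t e : ℕ} (hte : t ≤ e) (he : e ≤ lastEpoch f + 1) (p : Fin n) :
    (stateAt f F pro adv (3 * e) p).group.take t = (stateAt f F pro adv (3 * t) p).group := by
  induction e, hte using Nat.le_induction with
  | base => exact List.take_of_length_le (length_group he p).le
  | succ e hte ih =>
    obtain ⟨ρ, hρ⟩ := group_stateAt_succ (F := F) (pro := pro) (adv := adv)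
      (Nat.le_of_succ_le_succ he) p
    rw [hρ, List.take_append_of_le_length (by rw [length_group (by omega)]; exact hte),
      ih (by omega)]

/-- The values held in a state are allowed and come with valid certificates for the group. -/
def GacState.Valid (f : ℕ) (x : GacState n) : Prop :=
  ∀ v ∈ x.pro, v ∈ allowed n ∧ ∀ t, x.group[t]? = some Role.slave →
    (x.proofs v t).Supports (n - f) v (x.group.take t)

theorem carries_message {e : ℕ} (h1 : 1 ≤ e) (he : e ≤ lastEpoch f) {p : Fin n}
    (hval : (stateAt f F pro adv (3 * e) p).Valid f) {v : Val n}
    (hv : v ∈ (stateAt f F pro adv (3 * e) p).pro) :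
    ((stateAt f F pro adv (3 * e) p).message e).group = (stateAt f F pro adv (3 * e) p).group ∧
      ((stateAt f F pro adv (3 * e) p).message e).Carries (n - f) v := by
  rw [GacState.message, if_neg (by omega)]
  refine ⟨rfl, carries_update.mpr ⟨fun h => ?_, hv, (hval v hv).2⟩⟩
  have := length_group (F := F) (pro := pro) (adv := adv) (he.trans (Nat.le_succ _)) p
  rw [h, List.length_nil] at this
  omega

theorem subset_collected_of_valid (hn : 3 * f < n) (hF : F.card ≤ f) {e : ℕ} (h1 : 1 ≤ e)
    (he : e ≤ lastEpoch f) {p : Fin n} (hp : p ∉ F)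
    (hval : (stateAt f F pro adv (3 * e) p).Valid f) :
    (stateAt f F pro adv (3 * e) p).pro ⊆ collected f F pro adv e p := by
  intro v hv
  obtain ⟨hm, hr⟩ := delivery_of_correct (pro := pro) (adv := adv) hn hF he hp p
  obtain ⟨hg, hc⟩ := carries_message h1 he hval hv
  exact mem_collect.mpr ⟨(hval v hv).1, p, _, hm, by omega, hg, hc⟩

theorem valid_stateAt (hn : 3 * f < n) (hF : F.card ≤ f) {e : ℕ} (h1 : 1 ≤ e)
    (he : e ≤ lastEpoch f + 1) {p : Fin n} (hp : p ∉ F) :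
    (stateAt f F pro adv (3 * e) p).Valid f := by
  induction e, h1 using Nat.le_induction with
  | base =>
    obtain ⟨hV, hg, hpr, -⟩ := stateAt_epoch_zero (f := f) (F := F) (pro := pro) (adv := adv) p
    intro v hv
    rw [hV] at hv
    obtain ⟨hall, q, m, hm, hr, hmg, hc⟩ := mem_collect.mp hv
    refine ⟨hall, fun t ht => ?_⟩
    rw [hpr, hg]
    rw [hg] at ht
    refine supports_newProofs hv (by simp) (fun _ => ⟨q, m, hm, ?_, hmg, hc⟩) ht
    -- Ranks are at most `2`, so rank at least `2` is rank `2`.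
    have hle : (delivery f F pro adv 0 p q).rank ≤ 2 := by
      unfold delivery grade
      split
      · rfl
      · split <;> simp
    exact le_antisymm hle hr
  | succ e h1 ih =>
    have he' : e ≤ lastEpoch f := Nat.le_of_succ_le_succ he
    have hval := ih (by omega)
    rcases stateAt_epoch_succ (F := F) (pro := pro) (adv := adv) h1 he' p with h | h
    · -- A slave finds the certificates it needs in its own message.
      obtain ⟨-, hV, hg, hpr, -⟩ := h
      obtain ⟨hm, hr⟩ := delivery_of_correct (pro := pro) (adv := adv) hn hF he' hp p
      intro v hv
      rw [hV] at hv
      obtain ⟨hmg, hc⟩ := carries_message h1 he' hval hv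
      refine ⟨(hval v hv).1, fun t ht => ?_⟩
      rw [hpr, hg]
      rw [hg] at ht
      refine supports_newProofs hv (fun t ht => ⟨p, _, hm, ?_⟩)
        (fun _ => ⟨p, _, hm, hr, hmg, hc⟩) ht
      rw [← hmg] at ht ⊢
      exact supports_of_carries hc ht
    · obtain ⟨-, hV, hg, hpr, -⟩ := h
      intro v hv
      rw [hV] at hv
      obtain ⟨hall, q, m, hm, -, hmg, hc⟩ := mem_collect.mp hv
      refine ⟨hall, fun t ht => ?_⟩
      rw [hpr, hg]
      rw [hg] at ht
      refine supports_newProofs hv (fun t ht => ⟨q, m, hm, ?_⟩) (by simp) ht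
      rw [← hmg] at ht ⊢
      exact supports_of_carries hc ht

theorem pro_subset_collected (hn : 3 * f < n) (hF : F.card ≤ f) {e : ℕ} (h1 : 1 ≤ e)
    (he : e ≤ lastEpoch f) {p : Fin n} (hp : p ∉ F) :
    (stateAt f F pro adv (3 * e) p).pro ⊆ collected f F pro adv e p :=
  subset_collected_of_valid hn hF h1 he hp (valid_stateAt hn hF h1 (by omega) hp)

theorem pro_mono (hn : 3 * f < n) (hF : F.card ≤ f) {e e' : ℕ} (h1 : 1 ≤ e) (hee : e ≤ e')
    (he : e' ≤ lastEpoch f + 1) {p : Fin n} (hp : p ∉ F) :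
    (stateAt f F pro adv (3 * e) p).pro ⊆ (stateAt f F pro adv (3 * e') p).pro := by
  induction e', hee using Nat.le_induction with
  | base => exact subset_rfl
  | succ e' hee ih =>
    refine (ih (by omega)).trans ?_
    rcases stateAt_epoch_succ (F := F) (pro := pro) (adv := adv) (h1.trans hee)
      (Nat.le_of_succ_le_succ he) p with h | h
    · rw [h.2.1]
    · rw [h.2.1]
      exact pro_subset_collected hn hF (h1.trans hee) (Nat.le_of_succ_le_succ he) hp

/-! ### Bounds on the values of a group -/

variable (f F pro adv) in
open Classical in
/-- The values that are admissible for a group, expressed through the consequence of a seen-all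
proof: for each prefix of the group that ends with `slave`, the value was collected, in the epoch of
that classification, by all the correct participants that were then in the same group. -/
def admissible (g : Group) : Finset (Val n) :=
  (allowed n).filter fun v => ∀ t, g[t]? = some Role.slave → ∀ q ∉ F,
    (stateAt f F pro adv (3 * t) q).group = g.take t → v ∈ collected f F pro adv t q

theorem mem_admissible {g : Group} {v : Val n} : v ∈ admissible f F pro adv g ↔ v ∈ allowed n ∧
    ∀ t, g[t]? = some Role.slave → ∀ q ∉ F,
      (stateAt f F pro adv (3 * t) q).group = g.take t → v ∈ collected f F pro adv t q := by
  simp [admissible]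

theorem admissible_subset_allowed (g : Group) : admissible f F pro adv g ⊆ allowed n :=
  fun _ hv => (mem_admissible.mp hv).1

theorem admissible_append_subset (g l : Group) :
    admissible f F pro adv (g ++ l) ⊆ admissible f F pro adv g := by
  intro v hv
  rw [mem_admissible] at hv ⊢
  refine ⟨hv.1, fun t ht q hq hg => hv.2 t ?_ q hq ?_⟩
  · rwa [List.getElem?_append_left (List.getElem?_eq_some_iff.mp ht).1]
  · rwa [List.take_append_of_le_length (List.getElem?_eq_some_iff.mp ht).1.le]

theorem admissible_slave_subset {e : ℕ} (he : e ≤ lastEpoch f + 1) {p : Fin n} (hp : p ∉ F) :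
    admissible f F pro adv ((stateAt f F pro adv (3 * e) p).group ++ [Role.slave]) ⊆
      collected f F pro adv e p := by
  have hlen := length_group (F := F) (pro := pro) (adv := adv) he p
  intro v hv
  refine (mem_admissible.mp hv).2 e ?_ p hp ?_
  · rw [List.getElem?_append_right hlen.le, hlen]
    simp
  · rw [List.take_append_of_le_length hlen.ge, List.take_of_length_le hlen.le]

/-- A valid seen-all proof has `n - f` authentic signatures, so that the signed message was
delivered to all the correct participants. -/
theorem mem_collected_of_supports (hn : 3 * f < n) (hF : F.card ≤ f) {t : ℕ} {v : Val n}
    {g : Group} {c : Cert n} (hs : c.Sound (Authentic f F pro adv) t)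
    (hc : c.Supports (n - f) v g) (hv : v ∈ allowed n) {q : Fin n}
    (hq : (stateAt f F pro adv (3 * t) q).group = g) : v ∈ collected f F pro adv t q := by
  obtain ⟨s, b, Q, rfl, hQ, hb, hcar⟩ := exists_of_supports hc
  have hdel := delivery_of_signers hn hF hQ (fun q hq hqF => (hs _ _ _ rfl).2 q hq hqF) q
  exact mem_collect.mpr ⟨hv, s, b, hdel, one_le_rank_of_grade hdel, hb.trans hq.symm, hcar⟩

theorem pro_subset_admissible (hn : 3 * f < n) (hF : F.card ≤ f)
    (hunf : Unforgeable F ((gacFast n f).sent F pro adv)) {e : ℕ} (h1 : 1 ≤ e)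
    (he : e ≤ lastEpoch f + 1) {p : Fin n} (hp : p ∉ F) :
    (stateAt f F pro adv (3 * e) p).pro ⊆
      admissible f F pro adv (stateAt f F pro adv (3 * e) p).group := by
  intro v hv
  obtain ⟨hall, hsup⟩ := valid_stateAt hn hF h1 he hp v hv
  refine mem_admissible.mpr ⟨hall, fun t ht q hq hg => ?_⟩
  exact mem_collected_of_supports hn hF ((sound_stateAt hn hunf _ p hp).proofs v t) (hsup t ht)
    hall hg

theorem delivery_zero_of_correct (hn : 3 * f < n) (hF : F.card ≤ f) {s : Fin n} (hs : s ∉ F)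
    (p : Fin n) : (delivery f F pro adv 0 p s).msg = some (.propose (pro s)) ∧
      (delivery f F pro adv 0 p s).rank = 2 :=
  delivery_of_correct hn hF (Nat.zero_le _) hs p

/-- The proposals of all the correct participants are held after epoch `0`. -/
theorem pro_mem_stateAt_one (hn : 3 * f < n) (hF : F.card ≤ f)
    (hpro : ∀ p ∈ Fᶜ, pro p ∈ allowed n) (p : Fin n) {q : Fin n} (hq : q ∉ F) :
    pro q ∈ (stateAt f F pro adv (3 * 1) p).pro := by
  obtain ⟨hm, hr⟩ := delivery_zero_of_correct (pro := pro) (adv := adv) hn hF hq p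
  rw [(stateAt_epoch_zero p).1, mem_collect]
  refine ⟨hpro q (Finset.mem_compl.mpr hq), q, _, hm, hr.ge, rfl, ?_⟩
  rw [Msg.Carries]

/-- The thresholds of a participant bound the number of its values from below and the number of
values that are admissible for its group from above. -/
theorem thresholds (hn : 3 * f < n) (hF : F.card ≤ f) (hpro : ∀ p ∈ Fᶜ, pro p ∈ allowed n)
    (hinj : ∀ p ∈ Fᶜ, ∀ q ∈ Fᶜ, pro p = pro q → p = q) {e : ℕ} (h1 : 1 ≤ e)
    (he : e ≤ lastEpoch f + 1) {p : Fin n} (hp : p ∉ F) :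
    let x := stateAt f F pro adv (3 * e) p
    x.td ≤ x.tu ∧ x.td ≤ x.pro.card ∧ (admissible f F pro adv x.group).card ≤ x.tu := by
  intro x
  induction e, h1 using Nat.le_induction with
  | base =>
    obtain ⟨-, -, -, htd, htu⟩ := stateAt_epoch_zero (f := f) (F := F) (pro := pro) (adv := adv) p
    change x.td = n - f at htd
    change x.tu = n at htu
    rw [htd, htu]
    refine ⟨Nat.sub_le _ _, (le_card_compl hF).trans ?_,
      (Finset.card_le_card (admissible_subset_allowed _)).trans card_allowed_le⟩
    refine Finset.card_le_card_of_injOn pro (fun q hq => ?_) (fun q hq q' hq' => ?_)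
    · exact pro_mem_stateAt_one hn hF hpro p (Finset.mem_compl.mp hq)
    · exact hinj q hq q' hq'
  | succ e h1 ih =>
    have he' : e ≤ lastEpoch f := Nat.le_of_succ_le_succ he
    obtain ⟨hle, hlow, hup⟩ := ih (by omega)
    rcases stateAt_epoch_succ (F := F) (pro := pro) (adv := adv) h1 he' p with h | h
    · obtain ⟨hW, hV, hg, -, htd, htu⟩ := h
      refine ⟨?_, ?_, ?_⟩
      · rw [htd, htu]
        exact Nat.le_add_right _ _
      · rwa [htd, hV]
      · rw [hg, htu]
        exact (Finset.card_le_card (admissible_slave_subset (by omega) hp)).trans hW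
    · obtain ⟨hW, hV, hg, -, htd, htu⟩ := h
      refine ⟨?_, ?_, ?_⟩
      · rw [htd, htu, GacState.tm]
        omega
      · rw [htd, hV]
        exact hW.le
      · rw [hg, htu]
        exact (Finset.card_le_card (admissible_append_subset _ _)).trans hup

/-- The distance of the thresholds is at most `f ≤ 2 ^ ⌈log₂ f⌉` after epoch `0`, and each later epoch
halves it, rounding up. -/
theorem tu_sub_td_le {e : ℕ} (h1 : 1 ≤ e) (he : e ≤ lastEpoch f) (p : Fin n) :
    (stateAt f F pro adv (3 * e) p).tu - (stateAt f F pro adv (3 * e) p).td ≤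
      2 ^ (lastEpoch f - e) := by
  induction e, h1 using Nat.le_induction with
  | base =>
    obtain ⟨-, -, -, htd, htu⟩ := stateAt_epoch_zero (f := f) (F := F) (pro := pro) (adv := adv) p
    change (stateAt f F pro adv (3 * 1) p).td = _ at htd
    change (stateAt f F pro adv (3 * 1) p).tu = _ at htu
    have hf := Nat.le_pow_clog (b := 2) (by norm_num) f
    rw [htd, htu, lastEpoch, Nat.add_sub_cancel]
    omega
  | succ e h1 ih =>
    have ih := ih (by omega)
    rw [show lastEpoch f - e = lastEpoch f - (e + 1) + 1 by omega, pow_succ] at ih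
    rcases stateAt_epoch_succ (F := F) (pro := pro) (adv := adv) h1
      (Nat.le_of_succ_le he) p with h | h
    · obtain ⟨-, -, -, -, htd, htu⟩ := h
      rw [htd, htu, GacState.tm]
      omega
    · obtain ⟨-, -, -, -, htd, htu⟩ := h
      rw [htd, htu, GacState.tm]
      omega

/-- After the last epoch a participant holds all the values that are admissible for its group. -/
theorem pro_eq_admissible (hn : 3 * f < n) (hF : F.card ≤ f)
    (hpro : ∀ p ∈ Fᶜ, pro p ∈ allowed n)
    (hinj : ∀ p ∈ Fᶜ, ∀ q ∈ Fᶜ, pro p = pro q → p = q)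
    (hunf : Unforgeable F ((gacFast n f).sent F pro adv)) {p : Fin n} (hp : p ∉ F) :
    (stateAt f F pro adv (3 * (lastEpoch f + 1)) p).pro =
      admissible f F pro adv (stateAt f F pro adv (3 * (lastEpoch f + 1)) p).group := by
  have hsub := pro_subset_admissible hn hF hunf (by omega) le_rfl hp
  have hthr := thresholds (adv := adv) hn hF hpro hinj (lastEpoch_pos (f := f)) (by omega) hp
  have hgap := tu_sub_td_le (F := F) (pro := pro) (adv := adv) (lastEpoch_pos (f := f)) le_rfl p
  rw [Nat.sub_self, pow_zero] at hgap
  dsimp only at hthr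
  refine Finset.eq_of_subset_of_card_le hsub ?_
  -- The thresholds differ by at most `1`, so that `tm = td` in the last epoch.
  rcases stateAt_epoch_succ (F := F) (pro := pro) (adv := adv) (lastEpoch_pos (f := f)) le_rfl p
    with h | h
  · obtain ⟨hW, hV, hg, -⟩ := h
    have := Finset.card_le_card
      (admissible_slave_subset (pro := pro) (adv := adv) (Nat.le_succ (lastEpoch f)) hp)
    rw [GacState.tm] at hW
    rw [hV, hg]
    omega
  · obtain ⟨hW, hV, hg, -⟩ := h
    have := Finset.card_le_card (admissible_append_subset (f := f) (F := F) (pro := pro)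
      (adv := adv) (stateAt f F pro adv (3 * lastEpoch f) p).group [Role.master])
    rw [GacState.tm] at hW
    rw [hV, hg]
    omega

/-! ### Comparability -/

theorem eq_or_exists_split {g g' : Group} (h : g.length = g'.length) :
    g = g' ∨ ∃ t, g.take t = g'.take t ∧
      (g[t]? = some Role.slave ∧ g'[t]? = some Role.master ∨
        g[t]? = some Role.master ∧ g'[t]? = some Role.slave) := by
  induction g generalizing g' with
  | nil => exact .inl (List.length_eq_zero_iff.mp h.symm).symm
  | cons a g ih =>
    rcases g' with _ | ⟨b, g'⟩
    · simp at h
    · have key : a = b ∨ (a = .slave ∧ b = .master ∨ a = .master ∧ b = .slave) := by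
        cases a <;> cases b <;> simp
      rcases key with rfl | hab
      · rcases ih (Nat.succ.inj h) with rfl | ⟨t, ht, hs⟩
        · exact .inl rfl
        · exact .inr ⟨t + 1, by simpa using ht, by simpa using hs⟩
      · exact .inr ⟨0, rfl, by simpa using hab⟩

/-- If two groups part, then the values of the slave's side are contained in those of the master. -/
theorem pro_subset_of_split (hn : 3 * f < n) (hF : F.card ≤ f)
    (hunf : Unforgeable F ((gacFast n f).sent F pro adv)) {p q : Fin n} (hp : p ∉ F) (hq : q ∉ F)
    {N t : ℕ} (hN : N ≤ lastEpoch f + 1)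
    (htake : (stateAt f F pro adv (3 * N) p).group.take t =
      (stateAt f F pro adv (3 * N) q).group.take t)
    (hslave : (stateAt f F pro adv (3 * N) p).group[t]? = some Role.slave)
    (hmaster : (stateAt f F pro adv (3 * N) q).group[t]? = some Role.master) :
    (stateAt f F pro adv (3 * N) p).pro ⊆ (stateAt f F pro adv (3 * N) q).pro := by
  have htN : t < N := by
    obtain ⟨h, -⟩ := List.getElem?_eq_some_iff.mp hslave
    rwa [length_group hN] at h
  have hlast : (stateAt f F pro adv (3 * (t + 1)) q).group[t]? = some Role.master := by
    rw [← take_group (show t + 1 ≤ N from htN) hN, List.getElem?_take_of_lt (Nat.lt_succ_self t)]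
    exact hmaster
  have ht1 : 1 ≤ t := by
    rcases t.eq_zero_or_pos with rfl | h
    · rw [(stateAt_epoch_zero q).2.1] at hlast
      simp at hlast
    · exact h
  have hqV : (stateAt f F pro adv (3 * (t + 1)) q).pro = collected f F pro adv t q := by
    rcases stateAt_epoch_succ (F := F) (pro := pro) (adv := adv) ht1
      (show t ≤ lastEpoch f by omega) q with h | h
    · rw [h.2.2.1, List.getElem?_append_right (length_group (by omega) q).le,
        length_group (by omega) q] at hlast
      simp at hlast
    · exact h.2.1
  refine subset_trans (fun v hv => ?_) (pro_mono hn hF (Nat.succ_pos t) htN hN hq)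
  rw [hqV]
  refine (mem_admissible.mp (pro_subset_admissible hn hF hunf (by omega) hN hp hv)).2 t hslave q hq
    ?_
  rw [htake, take_group htN.le hN]

theorem pro_subset_or_subset (hn : 3 * f < n) (hF : F.card ≤ f)
    (hpro : ∀ p ∈ Fᶜ, pro p ∈ allowed n)
    (hinj : ∀ p ∈ Fᶜ, ∀ q ∈ Fᶜ, pro p = pro q → p = q)
    (hunf : Unforgeable F ((gacFast n f).sent F pro adv)) {p q : Fin n} (hp : p ∉ F)
    (hq : q ∉ F) :
    (stateAt f F pro adv (3 * (lastEpoch f + 1)) p).pro ⊆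
        (stateAt f F pro adv (3 * (lastEpoch f + 1)) q).pro ∨
      (stateAt f F pro adv (3 * (lastEpoch f + 1)) q).pro ⊆
        (stateAt f F pro adv (3 * (lastEpoch f + 1)) p).pro := by
  rcases eq_or_exists_split
    ((length_group (F := F) (pro := pro) (adv := adv) le_rfl p).trans
      (length_group (F := F) (pro := pro) (adv := adv) le_rfl q).symm) with h | ⟨t, ht, h | h⟩
  · left
    rw [pro_eq_admissible hn hF hpro hinj hunf hp, pro_eq_admissible hn hF hpro hinj hunf hq, h]
  · exact .inl (pro_subset_of_split hn hF hunf hp hq le_rfl ht h.1 h.2)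
  · exact .inr (pro_subset_of_split hn hF hunf hq hp le_rfl ht.symm h.2 h.1)

/-! ### Non-triviality -/

variable (f F pro adv) in
open Classical in
/-- The allowed values that Byzantine sources have gradecast to `p` in epoch `0`. -/
def byzantineValues (p : Fin n) : Finset (Val n) :=
  (allowed n).filter fun v => ∃ s ∈ F, (delivery f F pro adv 0 p s).msg = some (.propose v)

theorem mem_byzantineValues {p : Fin n} {v : Val n} : v ∈ byzantineValues f F pro adv p ↔
    v ∈ allowed n ∧ ∃ s ∈ F, (delivery f F pro adv 0 p s).msg = some (.propose v) := by
  simp [byzantineValues]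

theorem card_byzantineValues_le (p : Fin n) :
    (byzantineValues f F pro adv p).card ≤ F.card := by
  have : Nonempty (Fin n) := ⟨p⟩
  have hsrc : ∀ v ∈ byzantineValues f F pro adv p,
      ∃ s ∈ F, (delivery f F pro adv 0 p s).msg = some (.propose v) :=
    fun v hv => (mem_byzantineValues.mp hv).2
  choose! src hF hsrc using hsrc
  refine Finset.card_le_card_of_injOn src hF fun v hv w hw hvw => ?_
  have h := (hsrc v hv).symm.trans (hvw ▸ hsrc w hw)
  exact Msg.propose.inj (Option.some.inj h)

/-- Every value held after epoch `0` was collected in epoch `0` by each correct participant. -/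
theorem mem_of_mem_pro (hn : 3 * f < n) (hF : F.card ≤ f)
    (hunf : Unforgeable F ((gacFast n f).sent F pro adv)) {e : ℕ} (h1 : 1 ≤ e)
    (he : e ≤ lastEpoch f + 1) {p p₀ : Fin n} (hp : p ∉ F) (hp₀ : p₀ ∉ F) {v : Val n}
    (hv : v ∈ (stateAt f F pro adv (3 * e) p).pro) :
    (∃ s ∉ F, v = pro s) ∨ v ∈ byzantineValues f F pro adv p₀ := by
  have hslave : (stateAt f F pro adv (3 * e) p).group[0]? = some Role.slave := by
    rw [← List.getElem?_take_of_lt (Nat.lt_succ_self 0), take_group h1 he,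
      (stateAt_epoch_zero p).2.1]
    rfl
  obtain ⟨hall, h⟩ := mem_admissible.mp (pro_subset_admissible hn hF hunf h1 he hp hv)
  obtain ⟨-, s, m, hm, -, hg, hc⟩ := mem_collect.mp (h 0 hslave p₀ hp₀ rfl)
  obtain rfl := eq_propose_of_carries hg hc
  by_cases hs : s ∈ F
  · exact .inr (mem_byzantineValues.mpr ⟨hall, s, hs, hm⟩)
  · rw [(delivery_zero_of_correct hn hF hs p₀).1] at hm
    exact .inl ⟨s, hs, (Msg.propose.inj (Option.some.inj hm)).symm⟩

/-! ### Decisions -/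

theorem decision_endEpoch (e : ℕ) (P : Fin n → Delivery n) (x : GacState n) :
    (endEpoch f e P x).decision =
      if e = lastEpoch f then some ((endEpoch f e P x).pro.sup id) else x.decision := by
  unfold endEpoch endEpochZero endEpochSucc
  dsimp only
  split_ifs <;> rfl

theorem decision_eq_none {r : ℕ} (hr : r < 3 * (lastEpoch f + 1)) (p : Fin n) :
    (stateAt f F pro adv r p).decision = none := by
  induction r with
  | zero => rfl
  | succ r ih =>
    have ih := ih (by omega)
    rw [stateAt_succ, gacReceive]
    split_ifs
    · exact ih
    · exact ih
    · exact ih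
    · rw [decision_endEpoch, if_neg (by omega), ih]

theorem decision_eq_some {r : ℕ} (hr : 3 * (lastEpoch f + 1) ≤ r) (p : Fin n) :
    (stateAt f F pro adv r p).decision =
      some ((stateAt f F pro adv (3 * (lastEpoch f + 1)) p).pro.sup id) := by
  rw [stateAt_of_lastEpoch_lt hr, stateAt_epoch_three le_rfl, decision_endEpoch, if_pos rfl]

theorem out_eq (r : ℕ) (p : Fin n) :
    (gacFast n f).out F pro adv r p = (stateAt f F pro adv r p).decision := rfl

theorem out_eq_some_iff {r : ℕ} {p : Fin n} {d : Val n} :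
    (gacFast n f).out F pro adv r p = some d ↔ 3 * (lastEpoch f + 1) ≤ r ∧
      (stateAt f F pro adv (3 * (lastEpoch f + 1)) p).pro.sup id = d := by
  rw [out_eq]
  rcases lt_or_ge r (3 * (lastEpoch f + 1)) with h | h
  · simp [decision_eq_none h, h]
  · simp [decision_eq_some h, h]

theorem isLatticeAgreement_gacFast (hn : 3 * f < n) (hF : F.card ≤ f)
    (hpro : ∀ p ∈ Fᶜ, pro p ∈ allowed n)
    (hinj : ∀ p ∈ Fᶜ, ∀ q ∈ Fᶜ, pro p = pro q → p = q)
    (hunf : Unforgeable F ((gacFast n f).sent F pro adv)) :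
    IsLatticeAgreement (allowed n : Set (Val n)) f Fᶜ pro ((gacFast n f).out F pro adv) where
  liveness p _ := ⟨_, _, out_eq_some_iff.mpr ⟨le_rfl, rfl⟩⟩
  stability p _ r r' d hr h := by
    rw [out_eq_some_iff] at h ⊢
    exact ⟨h.1.trans hr, h.2⟩
  comparability p hp q hq r r' d d' h h' := by
    obtain rfl := (out_eq_some_iff.mp h).2
    obtain rfl := (out_eq_some_iff.mp h').2
    rw [Finset.mem_compl] at hp hq
    exact (pro_subset_or_subset hn hF hpro hinj hunf hp hq).imp Finset.sup_mono Finset.sup_mono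
  inclusivity p hp r d h := by
    obtain rfl := (out_eq_some_iff.mp h).2
    rw [Finset.mem_compl] at hp
    exact Finset.le_sup (f := id)
      (pro_mono hn hF le_rfl (by omega) le_rfl hp (pro_mem_stateAt_one hn hF hpro p hp))
  nonTriviality := by
    have hcard : 0 < (Fᶜ).card := (show 0 < n - f by omega).trans_le (le_card_compl hF)
    obtain ⟨p₀, hp₀⟩ := Finset.card_pos.mp hcard
    refine ⟨byzantineValues f F pro adv p₀, ?_, (card_byzantineValues_le p₀).trans hF, ?_⟩
    · exact fun v hv => (mem_byzantineValues.mp hv).1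
    · intro p hp r d h
      obtain rfl := (out_eq_some_iff.mp h).2
      refine Finset.sup_mono fun v hv => (@Finset.mem_union _ (_) _ _ _).mpr ?_
      rw [Finset.mem_compl] at hp hp₀
      rcases mem_of_mem_pro hn hF hunf (by omega) le_rfl hp hp₀ hv with ⟨s, hs, rfl⟩ | hB
      · exact .inl ((@Finset.mem_image _ _ (_) _ _ _).mpr ⟨s, Finset.mem_compl.mpr hs, rfl⟩)
      · exact .inr hB

end Epoch

/-! ### The number of rounds -/

theorem isBigO_rounds : (fun f : ℕ => ((3 * (lastEpoch f + 1) : ℕ) : ℝ)) =O[Filter.atTop]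
    (fun f : ℕ => Real.log (f : ℝ)) := by
  refine Asymptotics.IsBigO.of_bound (12 / Real.log 2) ?_
  filter_upwards [Filter.eventually_ge_atTop 2] with f hf
  have h2 : 0 < Real.log 2 := Real.log_pos one_lt_two
  have hf' : (2 : ℝ) ≤ f := by exact_mod_cast hf
  have hlog : 1 ≤ Real.logb 2 f := by
    rw [Real.le_logb_iff_rpow_le one_lt_two (by linarith), Real.rpow_one]
    exact hf'
  have hclog : (Nat.clog 2 f : ℝ) < Real.logb 2 f + 1 := by
    have h := Nat.ceil_lt_add_one (zero_le_one.trans hlog)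
    rwa [show ⌈Real.logb 2 f⌉₊ = Nat.clog 2 f from Real.natCeil_logb_natCast 2 f] at h
  rw [Real.norm_of_nonneg (Nat.cast_nonneg _), Real.norm_of_nonneg (Real.log_nonneg (by linarith)),
    div_mul_eq_mul_div, mul_div_assoc, Real.log_div_log]
  simp only [lastEpoch]
  push_cast
  linarith

end ByzLA

end

theorem mainTheorem3 :
    ∃ T : ℕ → ℕ,
      (fun f : ℕ => (T f : ℝ)) =O[Filter.atTop] (fun f : ℕ => Real.log (f : ℝ)) ∧
      ∀ (n f : ℕ), 3 * f < n →
      ∀ F : Finset (Fin n), F.card ≤ f →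
      ∀ pro : Fin n → ByzLA.Val n,
        (∀ p ∈ Fᶜ, pro p ∈ ByzLA.allowed n) →
        (∀ p ∈ Fᶜ, ∀ q ∈ Fᶜ, pro p = pro q → p = q) →
      ∀ adv : ℕ → Fin n → Fin n → ByzLA.Packet n,
        ByzLA.Unforgeable F ((ByzLA.gacFast n f).sent F pro adv) →
        ByzLA.IsLatticeAgreement (ByzLA.allowed n : Set (ByzLA.Val n)) f Fᶜ pro
            ((ByzLA.gacFast n f).out F pro adv) ∧
          ∀ p ∈ Fᶜ, ((ByzLA.gacFast n f).out F pro adv (T f) p).isSome := by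
  refine ⟨fun f => 3 * (ByzLA.lastEpoch f + 1), ByzLA.isBigO_rounds, ?_⟩
  intro n f hn F hF pro hpro hinj adv hunf
  refine ⟨ByzLA.isLatticeAgreement_gacFast hn hF hpro hinj hunf, fun p _ => ?_⟩
  rw [ByzLA.out_eq_some_iff.mpr ⟨le_rfl, rfl⟩]
  rfl
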